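/- Let $n\ge 1$ and $r\ge 1$ be integers, let $\mathfrak S_n$ be the set of permutations $\pi=\pi_1\pi_2\cdots\pi_n$ of $[n]=\{1,\dots,n\}$, and let $q$ be an indeterminate. For $\pi\in\mathfrak S_n$ let $$\mathsf{Des}(\pi)=\{i\in[n-1]:\pi_i>\pi_{i+1}\},\qquad \mathsf{PLrmax}(\pi)=\{i\in[n]:\pi_j<\pi_i\text{ for all }j<i\}$$ be the descent set and the set of positions of the left-to-right maxima of $\pi$. Define $$\mathsf{inv}(\pi)=|\{(i,j):1\le i<j\le n,\ \pi_i>\pi_j\}|,\qquad \mathsf{maj}(\pi)=\sum_{i\in\mathsf{Des}(\pi)}i,$$ $$\mathsf{inv}_r(\pi)=|\{(i,j):1\le i<j\le n,\ j<i+r,\ \pi_i>\pi_j\}|+\sum_{1\le i\le n-r,\ \pi_i>\pi_{i+r}}i,$$ $$\mathsf{mak}(\pi)=\sum_{i\in\mathsf{Des}(\pi)}\pi_{i+1}+\sum_{i=1}^n e_i(\pi),$$ where $e_i(\pi)$ is the number of maximal decreasing runs $\pi_a>\pi_{a+1}>\cdots>\pi_b$ of consecutive letters of $\pi$ with $i<a<b$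 and $\pi_a\ge\pi_i>\pi_b$. Put $\mathsf{imaj}(\pi)=\mathsf{maj}(\pi^{-1})$, $\mathsf{imak}(\pi)=\mathsf{mak}(\pi^{-1})$ and $\mathsf{iinv}_r(\pi)=\mathsf{inv}_r(\pi^{-1})$. **Theorem.** Let $S\subseteq[n-1]$ and $P\subseteq[n]$, and put $$\mathcal D^{\subseteq}_{n,P}(S)=\{\pi\in\mathfrak S_n:\mathsf{PLrmax}(\pi)=P,\ \mathsf{Des}(\pi)\subseteq S\},\qquad \mathcal D^{=}_{n,P}(S)=\{\pi\in\mathfrak S_n:\mathsf{PLrmax}(\pi)=P,\ \mathsf{Des}(\pi)=S\}.$$ Then, for each of the two sets $\mathcal D=\mathcal D^{\subseteq}_{n,P}(S)$ and $\mathcal D=\mathcal D^{=}_{n,P}(S)$, $$\sum_{\pi\in\mathcal D}q^{\mathsf{inv}(\pi)}=\sum_{\pi\in\mathcal D}q^{\mathsf{imaj}(\pi)}=\sum_{\pi\in\mathcal D}q^{\mathsf{imak}(\pi)}=\sum_{\pi\in\mathcal D}q^{\mathsf{iinv}_r(\pi)}.$$ -/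

import Mathlib

/-!
Permutation statistics. A permutation `π` of `[n] = {1, …, n}` is modelled by
`Equiv.Perm (Fin n)`; the element `i : Fin n` stands for the position, or the letter, `i + 1`.
All sets of positions below are finite sets of natural numbers counted from `1`.
-/

namespace PermStat

/-- `(i, j)` are consecutive positions, `j = i + 1`, and `π` has a descent there: `π_i > π_{i+1}`. -/
def IsDescentPair {n : ℕ} (π : Equiv.Perm (Fin n)) (i j : Fin n) : Prop :=
  j.val = i.val + 1 ∧ π j < π i

instance {n : ℕ} (π : Equiv.Perm (Fin n)) (i j : Fin n) : Decidable (IsDescentPair π i j) := by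
  unfold IsDescentPair; infer_instance

/-- The descent set `Des π = {i ∈ [n-1] : π_i > π_{i+1}}`. -/
def Des {n : ℕ} (π : Equiv.Perm (Fin n)) : Finset ℕ :=
  (Finset.univ.filter fun i : Fin n => ∃ j : Fin n, IsDescentPair π i j).image
    fun i => i.val + 1

/-- The set of positions of the left-to-right maxima: `i` such that `π_j < π_i` for all `j < i`. -/
def PLrmax {n : ℕ} (π : Equiv.Perm (Fin n)) : Finset ℕ :=
  (Finset.univ.filter fun i : Fin n => ∀ j : Fin n, j < i → π j < π i).image
    fun i => i.val + 1

/-- The number of inversions, i.e. of pairs `i < j` with `π_i > π_j`. -/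
def inv {n : ℕ} (π : Equiv.Perm (Fin n)) : ℕ :=
  (Finset.univ.filter fun p : Fin n × Fin n => p.1 < p.2 ∧ π p.2 < π p.1).card

/-- The major index: the sum of the descents. -/
def maj {n : ℕ} (π : Equiv.Perm (Fin n)) : ℕ :=
  ∑ i ∈ Des π, i

/-- Kadell's statistic
`inv_r π = |{(i, j) : i < j < i + r, π_i > π_j}| + ∑_{i : π_i > π_{i+r}} i`. -/
def invr (r : ℕ) {n : ℕ} (π : Equiv.Perm (Fin n)) : ℕ :=
  (Finset.univ.filter fun p : Fin n × Fin n =>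
      p.1 < p.2 ∧ p.2.val < p.1.val + r ∧ π p.2 < π p.1).card +
    ∑ p ∈ Finset.univ.filter (fun p : Fin n × Fin n =>
      p.2.val = p.1.val + r ∧ π p.2 < π p.1), (p.1.val + 1)

/-- The descent bottoms sum: the sum of the letters `π_{i+1}` over all descents `i`.
(The value of a letter of a permutation is the letter itself.) -/
def Dbot {n : ℕ} (π : Equiv.Perm (Fin n)) : ℕ :=
  ∑ p ∈ Finset.univ.filter (fun p : Fin n × Fin n => IsDescentPair π p.1 p.2),
    ((π p.2).val + 1)

/-- The positions `a, …, b` with `a < b` carry a proper descent block of `π`: a maximal run of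
consecutive positions, at least two of them, along which `π` decreases.
Its closer is `π a` and its opener is `π b`. -/
def IsProperDescentBlock {n : ℕ} (π : Equiv.Perm (Fin n)) (a b : Fin n) : Prop :=
  a < b ∧
  (∀ i j : Fin n, a ≤ i → j ≤ b → j.val = i.val + 1 → π j < π i) ∧
  (¬ ∃ i : Fin n, IsDescentPair π i a) ∧
  (¬ ∃ j : Fin n, IsDescentPair π b j)

instance {n : ℕ} (π : Equiv.Perm (Fin n)) (a b : Fin n) :
    Decidable (IsProperDescentBlock π a b) := by
  unfold IsProperDescentBlock; infer_instance

/-- The embracing number of the letter at position `i`: the number of proper descent blocks `B`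
strictly to the right of that position with `C(B) ≥ π_i > O(B)`, for `C(B)` the closer and `O(B)`
the opener of `B`. (A one-letter block cannot embrace anything.) -/
def embracingNumber {n : ℕ} (π : Equiv.Perm (Fin n)) (i : Fin n) : ℕ :=
  (Finset.univ.filter fun B : Fin n × Fin n =>
    IsProperDescentBlock π B.1 B.2 ∧ i < B.1 ∧ π i ≤ π B.1 ∧ π B.2 < π i).card

/-- The embracing sum. -/
def Res {n : ℕ} (π : Equiv.Perm (Fin n)) : ℕ :=
  ∑ i : Fin n, embracingNumber π i

/-- The statistic `mak = Dbot + Res`. -/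
def mak {n : ℕ} (π : Equiv.Perm (Fin n)) : ℕ :=
  Dbot π + Res π

/-- `imaj π = maj π⁻¹`. -/
def imaj {n : ℕ} (π : Equiv.Perm (Fin n)) : ℕ := maj π⁻¹

/-- `imak π = mak π⁻¹`. -/
def imak {n : ℕ} (π : Equiv.Perm (Fin n)) : ℕ := mak π⁻¹

/-- `iinv_r π = inv_r π⁻¹`. -/
def iinvr (r : ℕ) {n : ℕ} (π : Equiv.Perm (Fin n)) : ℕ := invr r π⁻¹

/-- The permutations of `[n]` with `PLrmax π = P` and `Des π ⊆ S`. -/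
def descSubset (n : ℕ) (P S : Finset ℕ) : Finset (Equiv.Perm (Fin n)) :=
  Finset.univ.filter fun π => PLrmax π = P ∧ Des π ⊆ S

/-- The permutations of `[n]` with `PLrmax π = P` and `Des π = S`. -/
def descEq (n : ℕ) (P S : Finset ℕ) : Finset (Equiv.Perm (Fin n)) :=
  Finset.univ.filter fun π => PLrmax π = P ∧ Des π = S

/-- The generating polynomial `∑_{π ∈ A} q^{st π}` in the indeterminate `q`. -/
noncomputable def genPoly {n : ℕ} (A : Finset (Equiv.Perm (Fin n)))
    (st : Equiv.Perm (Fin n) → ℕ) : Polynomial ℤ :=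
  ∑ π ∈ A, (Polynomial.X : Polynomial ℤ) ^ st π

end PermStat

/-!
For `π ∈ descSubset n P S`, the statistics `imaj`, `imak`, `iinvr r` are evaluated on the word
`π⁻¹`. Each of them is compared with `inv` on `descSubset n P S`; the statement for `descEq`
follows by induction on `S`, since `descSubset n P S` is the disjoint union of the sets
`descEq n P T` with `T ⊆ S`.

*Kadell's statistics, among them `maj = inv_1`.* Both `inv` and `iinvr r` are sums of weights over
the inversions `π⁻¹ a > π⁻¹ b`, `a < b`, of `π⁻¹`, the weight depending on a threshold attached to
`b`. The threshold of one letter `m` is lowered from `a + 1` to `a` at a time. The change of the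
statistic is compensated by an involution, which exchanges the letters `a` and `a + 1` of `π` if
the larger letter `m` stands between them (`weightedInv_swapIfSeparated`). This exchange alters
neither the descents nor the positions of the left-to-right maxima.

*The statistic `mak`.* Permutations are built by appending last letters, that is, by inserting the
largest letter into `π⁻¹`. Whether the result lies in the class depends only on the position of
insertion: it is the end exactly if a left-to-right maximum is required, and it lies to the right
of the previous largest letter if a descent is not allowed. For `inv` as well as for `mak` there
are labels `d` of the positions such that insertion at a position with label `d` raises the
statistic by `d + 1`, and the new labels are described by the same rule, `InsertionStatistic`. The
multiset of labels varies for `mak`, so one sums over the whole class the products of the factors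
`1 + y q ^ d` and `1 + z q ^ d`, taken over the positions up to and after that of the largest
letter, respectively. Summing over the position of insertion telescopes, so these sums satisfy a
recursion that does not mention the statistic (`genFun_succ_of_mem`, `genFun_succ_of_notMem`).
Hence they agree for `inv` and `mak`, and `y = z = 0` gives the equality of the generating
polynomials.
-/

namespace PermStat

open Equiv

/-! ### Weighted inversions of the inverse permutation -/

/-- The weight of the smaller letter `a` of an inversion when the threshold is `k`:
nothing below the threshold, `1` above it, and `a + 1` at the threshold itself. For `k = 0` the
weight is constantly `1`. -/
def thresholdWeight (k a : ℕ) : ℕ := if k < a then 1 else if a = k then a + 1 else 0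

/-- The sum of the weights of all inversions of `π⁻¹`, where an inversion with positions `a < b`
has the weight `thresholdWeight (κ b) a`. -/
def weightedInv (κ : ℕ → ℕ) {n : ℕ} (π : Perm (Fin n)) : ℕ :=
  ∑ p : Fin n × Fin n,
    if p.1 < p.2 ∧ π⁻¹ p.2 < π⁻¹ p.1 then thresholdWeight (κ p.2) p.1 else 0

theorem thresholdWeight_zero (a : ℕ) : thresholdWeight 0 a = 1 := by
  unfold thresholdWeight; split_ifs <;> omega

theorem weightedInv_congr {κ κ' : ℕ → ℕ} {n : ℕ} (h : ∀ v < n, κ v = κ' v)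
    (π : Perm (Fin n)) : weightedInv κ π = weightedInv κ' π := by
  unfold weightedInv
  exact Finset.sum_congr rfl fun p _ => by rw [h p.2 p.2.isLt]

theorem iinvr_eq_weightedInv {r : ℕ} (hr : 1 ≤ r) {n : ℕ} (π : Perm (Fin n)) :
    iinvr r π = weightedInv (fun v => v - r) π := by
  unfold iinvr invr weightedInv
  rw [Finset.card_filter, Finset.sum_filter, ← Finset.sum_add_distrib]
  refine Finset.sum_congr rfl fun p _ => ?_
  by_cases h : π⁻¹ p.2 < π⁻¹ p.1
  · simp only [h, and_true, thresholdWeight, Fin.lt_def]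
    split_ifs <;> omega
  · rw [if_neg (fun H => h H.2.2), if_neg (fun H => h H.2), if_neg (fun H => h H.2),
      add_zero]

theorem inv_eq_weightedInv {n : ℕ} (π : Perm (Fin n)) :
    inv π = weightedInv (fun _ => 0) π := by
  unfold inv weightedInv
  simp only [thresholdWeight_zero]
  rw [← Finset.card_filter]
  refine Finset.card_bij' (fun p _ => (π p.2, π p.1)) (fun p _ => (π⁻¹ p.2, π⁻¹ p.1)) ?_ ?_ ?_ ?_
  all_goals simp +contextual

theorem imaj_eq_iinvr_one {n : ℕ} (π : Perm (Fin n)) : imaj π = iinvr 1 π := by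
  unfold imaj iinvr
  generalize π⁻¹ = σ
  have h0 : (Finset.univ.filter fun p : Fin n × Fin n =>
      p.1 < p.2 ∧ p.2.val < p.1.val + 1 ∧ σ p.2 < σ p.1) = ∅ := by
    refine Finset.filter_false_of_mem fun p _ => ?_
    simp only [Fin.lt_def]; omega
  unfold maj Des invr
  rw [h0, Finset.card_empty, zero_add, Finset.sum_image (by intro a _ b _ h; ext; simpa using h)]
  symm
  refine Finset.sum_bij (fun p _ => p.1) ?_ ?_ ?_ ?_
  · rintro ⟨i, j⟩ h
    simp only [Finset.mem_filter, Finset.mem_univ, true_and] at h ⊢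
    exact ⟨j, h⟩
  · rintro ⟨i, j⟩ h ⟨i', j'⟩ h' e
    simp only [Finset.mem_filter, Finset.mem_univ, true_and] at h h' e
    subst e
    have : j = j' := Fin.ext (by omega)
    rw [this]
  · intro i h
    simp only [Finset.mem_filter, Finset.mem_univ, true_and] at h
    obtain ⟨j, hj⟩ := h
    exact ⟨(i, j), by simpa [IsDescentPair] using hj, rfl⟩
  · intros; rfl

theorem inv_apply_self' {α : Type*} (π : Perm α) (x : α) : π⁻¹ (π x) = x := π.symm_apply_apply x

theorem apply_inv_self' {α : Type*} (π : Perm α) (x : α) : π (π⁻¹ x) = x := π.apply_symm_apply x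

/-! ### Exchanging two letters separated by a larger one -/

/-- In the word `π`, the letter `m` stands between the letters `a` and `b`. -/
def Separates {n : ℕ} (m a b : Fin n) (π : Perm (Fin n)) : Prop :=
  (π⁻¹ a < π⁻¹ m ∧ π⁻¹ m < π⁻¹ b) ∨ (π⁻¹ b < π⁻¹ m ∧ π⁻¹ m < π⁻¹ a)

open Classical in
/-- Exchange the letters `a` and `b` of `π` if the letter `m` stands between them. -/
noncomputable def swapIfSeparated {n : ℕ} (m a b : Fin n) (π : Perm (Fin n)) : Perm (Fin n) :=
  if Separates m a b π then swap a b * π else π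

section

variable {n : ℕ} {m a b : Fin n}

theorem separates_swap_mul (ha : m ≠ a) (hb : m ≠ b) {π : Perm (Fin n)}
    (h : Separates m a b π) : Separates m a b (swap a b * π) := by
  unfold Separates at *
  simp only [mul_inv_rev, swap_inv, Perm.mul_apply, swap_apply_left, swap_apply_right,
    swap_apply_of_ne_of_ne ha hb]
  tauto

theorem swapIfSeparated_involutive (ha : m ≠ a) (hb : m ≠ b) (π : Perm (Fin n)) :
    swapIfSeparated m a b (swapIfSeparated m a b π) = π := by
  by_cases h : Separates m a b π
  · rw [swapIfSeparated, swapIfSeparated, if_pos h, if_pos (separates_swap_mul ha hb h),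
      swap_mul_self_mul]
  · rw [swapIfSeparated, swapIfSeparated, if_neg h, if_neg h]

theorem swap_lt_swap_iff (hab : b.val = a.val + 1) {x y : Fin n}
    (h : ¬ (x = a ∧ y = b)) (h' : ¬ (x = b ∧ y = a)) :
    swap a b x < swap a b y ↔ x < y := by
  simp only [swap_apply_def, Fin.lt_def, Fin.ext_iff] at *
  split_ifs <;> omega

theorem des_swap_mul (hab : b.val = a.val + 1) {π : Perm (Fin n)} (h : Separates m a b π) :
    Des (swap a b * π) = Des π := by
  have key : ∀ i j, IsDescentPair (swap a b * π) i j ↔ IsDescentPair π i j := by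
    intro i j
    unfold IsDescentPair
    refine and_congr_right fun hij => ?_
    refine swap_lt_swap_iff hab ?_ ?_
    all_goals
      rintro ⟨rfl, rfl⟩
      simp only [Separates, inv_apply_self', Fin.lt_def] at h
      omega
  simp only [Des, key]

theorem plrmax_swap_mul (hab : b.val = a.val + 1) (hbm : b < m) {π : Perm (Fin n)}
    (h : Separates m a b π) : PLrmax (swap a b * π) = PLrmax π := by
  have key : ∀ i, (∀ j, j < i → (swap a b * π) j < (swap a b * π) i) ↔
      (∀ j, j < i → π j < π i) := by
    intro i
    simp only [Perm.mul_apply]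
    have hm : swap a b m = m := swap_apply_of_ne_of_ne (by rw [Fin.lt_def] at hbm; rintro rfl; omega)
      (by rintro rfl; exact lt_irrefl _ hbm)
    by_cases hi : (π i = a ∨ π i = b) ∧ π⁻¹ m < i
    · -- the larger letter `m` precedes `i`, so `i` is a left-to-right maximum of neither word
      obtain ⟨hi, hmi⟩ := hi
      refine iff_of_false (fun H => ?_) (fun H => ?_)
      · have := H _ hmi
        rw [apply_inv_self', hm] at this
        rcases hi with hi | hi <;> rw [hi] at this <;>
          simp only [swap_apply_left, swap_apply_right, Fin.lt_def] at this hbm <;> omega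
      · have := H _ hmi
        rw [apply_inv_self'] at this
        rcases hi with hi | hi <;> rw [hi, Fin.lt_def] at this <;> rw [Fin.lt_def] at hbm <;> omega
    · refine forall_congr' fun j => forall_congr' fun hj => swap_lt_swap_iff hab ?_ ?_
      all_goals
        rintro ⟨rfl, rfl⟩
        simp only [Separates, inv_apply_self', true_or, or_true, true_and] at h hi
        omega
  simp only [PLrmax, key]

theorem swapIfSeparated_mem_descSubset (hab : b.val = a.val + 1) (hbm : b < m) {P S : Finset ℕ}
    {π : Perm (Fin n)} (h : π ∈ descSubset n P S) :
    swapIfSeparated m a b π ∈ descSubset n P S := by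
  unfold swapIfSeparated
  split_ifs with hs
  · simp only [descSubset, Finset.mem_filter, Finset.mem_univ, true_and] at h ⊢
    rwa [des_swap_mul hab hs, plrmax_swap_mul hab hbm hs]
  · exact h

/-- Lowering the threshold of `m` from `b = a + 1` to `a` is compensated by the exchange of the
letters `a` and `b`, if `m` stands between them, and changes nothing otherwise. -/
theorem weightedInv_swapIfSeparated (hab : b.val = a.val + 1) (hbm : b < m) {κ : ℕ → ℕ}
    (hκm : κ m = b) (hlt : ∀ v < m.val, κ v = 0) (hgt : ∀ v, m.val < v → b.val < κ v)
    (π : Perm (Fin n)) :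
    weightedInv (Function.update κ m a) (swapIfSeparated m a b π) = weightedInv κ π := by
  have hna : m ≠ a := by rw [Fin.lt_def] at hbm; rintro rfl; omega
  have hnb : m ≠ b := by rintro rfl; exact lt_irrefl _ hbm
  have hnab : a ≠ b := by rintro rfl; omega
  rw [Fin.lt_def] at hbm
  unfold swapIfSeparated
  split_ifs with hs
  · let e : Fin n × Fin n ≃ Fin n × Fin n := (swap a b).prodCongr (swap a b)
    have hR : weightedInv (Function.update κ m a) (swap a b * π) =
        ∑ p : Fin n × Fin n, if swap a b p.1 < swap a b p.2 ∧ π⁻¹ p.2 < π⁻¹ p.1 then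
          thresholdWeight (Function.update κ m a (swap a b p.2)) (swap a b p.1) else 0 := by
      unfold weightedInv
      rw [← Equiv.sum_comp e]
      refine Finset.sum_congr rfl fun p _ => ?_
      simp [e]
    rw [hR, weightedInv]
    -- after reindexing by the exchange, only four pairs of letters contribute differently
    let T : Finset (Fin n × Fin n) := {(b, a), (a, b), (a, m), (b, m)}
    rw [← Finset.sum_add_sum_compl T, ← Finset.sum_add_sum_compl T (fun p : Fin n × Fin n =>
      if p.1 < p.2 ∧ π⁻¹ p.2 < π⁻¹ p.1 then thresholdWeight (κ p.2) p.1 else 0)]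
    congr 1
    · have h0b : κ b = 0 := hlt _ hbm
      have h0a : κ a = 0 := hlt _ (by omega)
      have e1 : b.val ≠ m.val := by omega
      have hT : ∀ f : Fin n × Fin n → ℕ,
          ∑ p ∈ T, f p = f (b, a) + (f (a, b) + (f (a, m) + f (b, m))) := by
        intro f
        rw [Finset.sum_insert (by simp [hna.symm, hnab, hnab.symm]),
          Finset.sum_insert (by simp [hnb.symm, hnab]), Finset.sum_pair (by simp [hnab])]
      rw [hT, hT]
      simp only [swap_apply_left, swap_apply_right, swap_apply_of_ne_of_ne hna hnb,
        Function.update_self, Function.update_of_ne e1, h0b, h0a, hκm, thresholdWeight_zero]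
      simp only [thresholdWeight]
      have hab' : a < b := by rw [Fin.lt_def]; omega
      have ham' : a < m := by rw [Fin.lt_def]; omega
      have hbm' : b < m := by rw [Fin.lt_def]; omega
      simp only [Separates] at hs
      generalize π⁻¹ = σ at hs ⊢
      rcases hs with ⟨h1, h2⟩ | ⟨h1, h2⟩
      · simp [hab', ham', hbm', hab'.not_gt, h1.not_gt, (h1.trans h2).not_gt, h2, h1.trans h2, hab,
          add_comm]
      · simp [ham', hbm', hab', hab'.not_gt, h1.not_gt, (h1.trans h2).not_gt, h2, h1.trans h2,
          show a.val ≠ b.val by omega]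
    · refine Finset.sum_congr rfl fun p hp => ?_
      obtain ⟨u, v⟩ := p
      simp only [T, Finset.mem_compl, Finset.mem_insert, Finset.mem_singleton, Prod.mk.injEq,
        not_or] at hp
      have hw : swap a b u < swap a b v ↔ u < v := swap_lt_swap_iff hab (by tauto) (by tauto)
      simp only [hw]
      by_cases huv : u < v ∧ π⁻¹ v < π⁻¹ u
      · rw [if_pos huv, if_pos huv]
        have hav : κ (swap a b v) = κ v := by
          rcases eq_or_ne v a with rfl | h1
          · rw [swap_apply_left, hlt _ hbm, hlt _ (by omega)]
          rcases eq_or_ne v b with rfl | h2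
          · rw [swap_apply_right, hlt _ hbm, hlt _ (by omega)]
          rw [swap_apply_of_ne_of_ne h1 h2]
        rcases lt_trichotomy v.val m.val with hv | hv | hv
        · have hne : (swap a b v).val ≠ m.val := by
            rw [swap_apply_def]; split_ifs <;> omega
          rw [Function.update_of_ne hne, hav, hlt _ hv, thresholdWeight_zero, thresholdWeight_zero]
        · obtain rfl : v = m := Fin.ext hv
          have h1 : u ≠ a := fun h => hp.2.2.1 ⟨h, rfl⟩
          have h2 : u ≠ b := fun h => hp.2.2.2 ⟨h, rfl⟩
          rw [swap_apply_of_ne_of_ne hna hnb, swap_apply_of_ne_of_ne h1 h2, Function.update_self,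
            hκm]
          rw [ne_eq, Fin.ext_iff] at h1 h2
          simp only [thresholdWeight]
          split_ifs <;> omega
        · have h1 : v ≠ a := by rintro rfl; omega
          have h2 : v ≠ b := by rintro rfl; omega
          have h3 := hgt _ hv
          rw [swap_apply_of_ne_of_ne h1 h2, Function.update_of_ne (by omega)]
          simp only [thresholdWeight, swap_apply_def, Fin.ext_iff]
          split_ifs <;> omega
      · rw [if_neg huv, if_neg huv]
  · rw [weightedInv, weightedInv]
    let T : Finset (Fin n × Fin n) := {(a, m), (b, m)}
    rw [← Finset.sum_add_sum_compl T, ← Finset.sum_add_sum_compl T (fun p : Fin n × Fin n =>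
      if p.1 < p.2 ∧ π⁻¹ p.2 < π⁻¹ p.1 then thresholdWeight (κ p.2) p.1 else 0)]
    congr 1
    · simp only [T]
      rw [Finset.sum_pair (by simp [hnab]), Finset.sum_pair (by simp [hnab])]
      have ia : π⁻¹ m ≠ π⁻¹ a := fun h => hna (π⁻¹.injective h)
      have ib : π⁻¹ m ≠ π⁻¹ b := fun h => hnb (π⁻¹.injective h)
      simp only [Function.update_self, hκm, thresholdWeight]
      simp only [Separates] at hs
      have hab' : a < b := by rw [Fin.lt_def]; omega
      have ham' : a < m := by rw [Fin.lt_def]; omega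
      have hbm' : b < m := by rw [Fin.lt_def]; omega
      generalize π⁻¹ = σ at *
      rcases lt_or_gt_of_ne ia with h1 | h1 <;> rcases lt_or_gt_of_ne ib with h2 | h2
      · simp [ham', hbm', h1, h2, hab, add_assoc]
      · exact absurd (Or.inr ⟨h2, h1⟩) hs
      · exact absurd (Or.inl ⟨h1, h2⟩) hs
      · simp [h1.not_gt, h2.not_gt]
    · refine Finset.sum_congr rfl fun p hp => ?_
      obtain ⟨u, v⟩ := p
      simp only [T, Finset.mem_compl, Finset.mem_insert, Finset.mem_singleton, Prod.mk.injEq,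
        not_or] at hp
      by_cases huv : u < v ∧ π⁻¹ v < π⁻¹ u
      · rw [if_pos huv, if_pos huv]
        rcases eq_or_ne v m with rfl | hv
        · have h1 : u.val ≠ a.val := fun h => hp.1 ⟨Fin.ext h, rfl⟩
          have h2 : u.val ≠ b.val := fun h => hp.2 ⟨Fin.ext h, rfl⟩
          simp only [Function.update_self, hκm, thresholdWeight]
          split_ifs <;> omega
        · rw [Function.update_of_ne (fun h => hv (Fin.ext h))]
      · rw [if_neg huv, if_neg huv]

end

/-! ### Kadell's statistics on a class with given left-to-right maxima -/

/-- The thresholds on the way from `inv_r` to `inv`: those of the letters below `m` are already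
`0`, that of `m` is `k`, and those of the letters `v` above `m` are still `v - r`. -/
def partialThreshold (r m k v : ℕ) : ℕ := if v < m then 0 else if v = m then k else v - r

theorem genPoly_partialThreshold {n r m k : ℕ} (hm : m < n) (hk : k ≤ m - r) (hr : 1 ≤ r)
    (P S : Finset ℕ) :
    genPoly (descSubset n P S) (weightedInv (partialThreshold r m k)) =
      genPoly (descSubset n P S) (weightedInv (partialThreshold r m 0)) := by
  induction k with
  | zero => rfl
  | succ k ih =>
    rw [← ih (by omega)]
    have hab : (⟨k + 1, by omega⟩ : Fin n).val = (⟨k, by omega⟩ : Fin n).val + 1 := rfl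
    have hbm : (⟨k + 1, by omega⟩ : Fin n) < ⟨m, hm⟩ := by rw [Fin.mk_lt_mk]; omega
    have hna : (⟨m, hm⟩ : Fin n) ≠ ⟨k, by omega⟩ := by rw [ne_eq, Fin.mk.injEq]; omega
    have hnb : (⟨m, hm⟩ : Fin n) ≠ ⟨k + 1, by omega⟩ := hbm.ne'
    refine Finset.sum_bij' (fun π _ => swapIfSeparated ⟨m, hm⟩ ⟨k, by omega⟩ ⟨k + 1, by omega⟩ π)
      (fun π _ => swapIfSeparated ⟨m, hm⟩ ⟨k, by omega⟩ ⟨k + 1, by omega⟩ π)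
      (fun π h => swapIfSeparated_mem_descSubset hab hbm h)
      (fun π h => swapIfSeparated_mem_descSubset hab hbm h)
      (fun π _ => swapIfSeparated_involutive hna hnb π)
      (fun π _ => swapIfSeparated_involutive hna hnb π) (fun π _ => ?_)
    rw [← weightedInv_swapIfSeparated hab hbm (κ := partialThreshold r m (k + 1))]
    · congr 2
      funext v
      simp only [partialThreshold, Function.update_apply]
      split_ifs <;> omega
    · simp [partialThreshold]
    · intro v hv
      simp [partialThreshold, show v < m from hv]
    · intro v hv
      simp only [partialThreshold] at hv ⊢
      split_ifs <;> omega

theorem genPoly_iinvr {r : ℕ} (hr : 1 ≤ r) (n : ℕ) (P S : Finset ℕ) :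
    genPoly (descSubset n P S) (iinvr r) = genPoly (descSubset n P S) inv := by
  have key : ∀ m ≤ n, genPoly (descSubset n P S) (iinvr r) =
      genPoly (descSubset n P S) (weightedInv (partialThreshold r m (m - r))) := by
    intro m hm
    induction m with
    | zero =>
      refine Finset.sum_congr rfl fun π _ => ?_
      rw [iinvr_eq_weightedInv hr]
      congr 2
      funext v
      simp only [partialThreshold]
      split_ifs <;> omega
    | succ m ih =>
      rw [ih (by omega), genPoly_partialThreshold (by omega) le_rfl hr]
      congr 2
      funext v
      simp only [partialThreshold]
      split_ifs <;> omega
  rw [key n le_rfl]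
  refine Finset.sum_congr rfl fun π _ => ?_
  rw [inv_eq_weightedInv]
  exact congrArg _ (weightedInv_congr (fun v hv => by simp [partialThreshold, hv]) π)

/-! ### Appending a last letter -/

/-- The permutation obtained from `π` by appending the letter `g` at the end, the letters `≥ g` of
`π` being raised by one. In the word `π⁻¹`, this inserts the largest letter at position `g`. -/
def insertLast {n : ℕ} (g : Fin (n + 1)) (π : Perm (Fin n)) : Perm (Fin (n + 1)) :=
  finSuccEquivLast.trans ((optionCongr π).trans (finSuccEquiv' g).symm)

section

variable {n : ℕ} (g : Fin (n + 1)) (π : Perm (Fin n))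

@[simp]
theorem insertLast_castSucc (i : Fin n) : insertLast g π i.castSucc = g.succAbove (π i) := by
  simp [insertLast]

@[simp]
theorem insertLast_last : insertLast g π (Fin.last n) = g := by
  simp [insertLast]

theorem insertLast_inv_self : (insertLast g π)⁻¹ g = Fin.last n := by
  rw [Perm.inv_eq_iff_eq, insertLast_last]

theorem insertLast_inv_succAbove (j : Fin n) :
    (insertLast g π)⁻¹ (g.succAbove j) = (π⁻¹ j).castSucc := by
  rw [Perm.inv_eq_iff_eq, insertLast_castSucc, apply_inv_self']

end

theorem insertLast_bijective (n : ℕ) :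
    Function.Bijective fun p : Perm (Fin n) × Fin (n + 1) => insertLast p.2 p.1 := by
  rw [Fintype.bijective_iff_injective_and_card]
  constructor
  · rintro ⟨π, g⟩ ⟨π', g'⟩ h
    have hg : g = g' := by
      simpa using DFunLike.congr_fun h (Fin.last n)
    subst hg
    have hπ : π = π' := by
      ext i : 1
      simpa using DFunLike.congr_fun h i.castSucc
    rw [hπ]
  · simp [Fintype.card_perm, Nat.factorial_succ, mul_comm]

theorem sum_perm_succ {M : Type*} [AddCommMonoid M] {n : ℕ} (F : Perm (Fin (n + 1)) → M) :
    ∑ π, F π = ∑ π : Perm (Fin n), ∑ g, F (insertLast g π) := by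
  rw [← Fintype.sum_prod_type' (fun π g => F (insertLast g π))]
  exact ((insertLast_bijective n).sum_comp F).symm

/-- The condition defining `descSubset n P S`, in a form in which `P` and `S` do not depend on
`n`. -/
def InClass (P S : Finset ℕ) {n : ℕ} (π : Perm (Fin n)) : Prop :=
  (∀ i : Fin n, i.val + 1 ∈ P ↔ ∀ j, j < i → π j < π i) ∧
    ∀ i j : Fin n, IsDescentPair π i j → i.val + 1 ∈ S

theorem mem_descSubset_iff {n : ℕ} {P S : Finset ℕ} (hP : P ⊆ Finset.Icc 1 n)
    (π : Perm (Fin n)) : π ∈ descSubset n P S ↔ InClass P S π := by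
  simp only [descSubset, Finset.mem_filter, Finset.mem_univ, true_and, InClass]
  refine and_congr ?_ ?_
  · constructor
    · rintro rfl i
      simp only [PLrmax, Finset.mem_image, Finset.mem_filter, Finset.mem_univ, true_and]
      constructor
      · rintro ⟨i', h, e⟩
        obtain rfl : i' = i := Fin.ext (by omega)
        exact h
      · exact fun h => ⟨i, h, rfl⟩
    · intro h
      ext k
      simp only [PLrmax, Finset.mem_image, Finset.mem_filter, Finset.mem_univ, true_and, ← h]
      constructor
      · rintro ⟨i, h, rfl⟩
        exact h
      · intro hk
        have := Finset.mem_Icc.1 (hP hk)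
        exact ⟨⟨k - 1, by omega⟩, by simpa [Nat.sub_add_cancel this.1] using hk,
          Nat.sub_add_cancel this.1⟩
  · simp only [Des, Finset.image_subset_iff, Finset.mem_filter, Finset.mem_univ, true_and]
    exact ⟨fun h i j hij => h i ⟨j, hij⟩, fun h i ⟨j, hij⟩ => h i j hij⟩

/-- The smallest letter that can be appended to `π` without creating a descent. -/
def startGap : ∀ {n : ℕ}, Perm (Fin n) → ℕ
  | 0, _ => 0
  | n + 1, π => (π (Fin.last n)).val + 1

theorem startGap_le : ∀ {n : ℕ} (π : Perm (Fin n)), startGap π ≤ n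
  | 0, _ => le_rfl
  | n + 1, π => (π (Fin.last n)).isLt

theorem startGap_insertLast {n : ℕ} (g : Fin (n + 1)) (π : Perm (Fin n)) :
    startGap (insertLast g π) = g.val + 1 := by
  simp [startGap]

theorem insertLast_last_lrmax_iff {n : ℕ} (g : Fin (n + 1)) (π : Perm (Fin n)) :
    (∀ j, j < Fin.last n → insertLast g π j < insertLast g π (Fin.last n)) ↔ g = Fin.last n := by
  rw [insertLast_last]
  constructor
  · intro h
    by_contra hg
    have hne : (insertLast g π)⁻¹ (Fin.last n) ≠ Fin.last n := by
      rw [ne_eq, Perm.inv_eq_iff_eq, insertLast_last]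
      exact fun h => hg h.symm
    have := h _ (lt_of_le_of_ne (Fin.le_last _) hne)
    rw [apply_inv_self'] at this
    exact this.not_ge (Fin.le_last _)
  · rintro rfl j hj
    refine lt_of_le_of_ne (Fin.le_last _) fun h => hj.ne ?_
    refine (insertLast (Fin.last n) π).injective ?_
    rw [h, insertLast_last]

theorem inClass_insertLast_iff {P S : Finset ℕ} {n : ℕ} (g : Fin (n + 1)) (π : Perm (Fin n)) :
    InClass P S (insertLast g π) ↔
      InClass P S π ∧ (n + 1 ∈ P ↔ g = Fin.last n) ∧ (n ∈ S ∨ startGap π ≤ g.val) := by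
  have h1 : (∀ i : Fin (n + 1), i.val + 1 ∈ P ↔
      ∀ j, j < i → insertLast g π j < insertLast g π i) ↔
      (∀ i : Fin n, i.val + 1 ∈ P ↔ ∀ j, j < i → π j < π i) ∧ (n + 1 ∈ P ↔ g = Fin.last n) := by
    rw [Fin.forall_fin_succ', insertLast_last_lrmax_iff]
    refine and_congr (forall_congr' fun i => ?_) Iff.rfl
    rw [Fin.forall_fin_succ']
    simp [(Fin.castSucc_lt_last i).not_gt]
  have h2 : (∀ i j : Fin (n + 1), IsDescentPair (insertLast g π) i j → i.val + 1 ∈ S) ↔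
      (∀ i j : Fin n, IsDescentPair π i j → i.val + 1 ∈ S) ∧ (n ∈ S ∨ startGap π ≤ g.val) := by
    constructor
    · intro h
      constructor
      · intro i j hij
        refine h i.castSucc j.castSucc ?_
        simpa [IsDescentPair] using hij
      · cases n with
        | zero => exact Or.inr (Nat.zero_le _)
        | succ n =>
          rw [or_iff_not_imp_right]
          intro hlt
          refine h (Fin.last n).castSucc (Fin.last (n + 1)) ⟨rfl, ?_⟩
          rw [insertLast_last, insertLast_castSucc, Fin.lt_succAbove_iff_le_castSucc, Fin.le_def]
          simp only [startGap] at hlt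
          simp only [Fin.val_castSucc]
          omega
    · rintro ⟨h, hn⟩ i j hij
      induction j using Fin.lastCases with
      | cast j =>
        induction i using Fin.lastCases with
        | cast i => exact h i j (by simpa [IsDescentPair] using hij)
        | last =>
          have := hij.1
          simp only [Fin.val_castSucc, Fin.val_last] at this
          omega
      | last =>
        obtain ⟨e, hlt⟩ := hij
        simp only [Fin.val_last] at e
        rw [← e]
        refine hn.resolve_right fun hle => ?_
        cases n with
        | zero => exact absurd e (by omega)
        | succ n =>
          obtain rfl : i = (Fin.last n).castSucc := Fin.ext (by simp; omega)
          rw [insertLast_last, insertLast_castSucc, Fin.lt_succAbove_iff_le_castSucc,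
            Fin.le_def] at hlt
          simp only [startGap] at hle
          simp only [Fin.val_castSucc] at hlt
          omega
  unfold InClass
  rw [h1, h2]
  tauto

/-! ### Insertion statistics -/

/-- A statistic `stat` on permutations together with labels `label π 0, …, label π (n - 1)` of the
positions of the letters of `π⁻¹`, such that inserting a new largest letter into `π⁻¹` before
position `g < n` increases `stat` by `label π g + 1`, inserting it at the end does not change
`stat`, and the new labels are, as multisets,
* at positions `≤ g`: the old labels at positions `< g`, and `n`;
* at positions `> g`: the old labels at positions `> g`, increased by `1`, and `0`.

The equalities of multisets are expressed through products of an arbitrary function. -/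
structure InsertionStatistic where
  /-- The statistic. -/
  stat : ∀ {n : ℕ}, Perm (Fin n) → ℕ
  /-- The labels of the positions. -/
  label : ∀ {n : ℕ}, Perm (Fin n) → ℕ → ℕ
  stat_zero : ∀ π : Perm (Fin 0), stat π = 0
  stat_insertLast_last : ∀ {n : ℕ} (π : Perm (Fin n)),
    stat (insertLast (Fin.last n) π) = stat π
  stat_insertLast_castSucc : ∀ {n : ℕ} (π : Perm (Fin n)) (g : Fin n),
    stat (insertLast g.castSucc π) = stat π + (label π g + 1)
  prod_label_le : ∀ {n : ℕ} (π : Perm (Fin n)) (g : Fin (n + 1)) (F : ℕ → ℝ),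
    ∏ j ∈ Finset.range (g + 1), F (label (insertLast g π) j) =
      F n * ∏ j ∈ Finset.range g, F (label π j)
  prod_label_gt : ∀ {n : ℕ} (π : Perm (Fin n)) (g : Fin n) (F : ℕ → ℝ),
    ∏ j ∈ Finset.Ico (g + 1 : ℕ) (n + 1), F (label (insertLast g.castSucc π) j) =
      F 0 * ∏ j ∈ Finset.Ico (g + 1 : ℕ) n, F (label π j + 1)

namespace InsertionStatistic

variable (s : InsertionStatistic) {n : ℕ}

/-- The product of the factors `1 + y q ^ d` over the labels `d` before position `t`, and of the
factors `1 + z q ^ d` over the other labels. -/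
noncomputable def labelProd (q : ℝ) (π : Perm (Fin n)) (t : ℕ) (y z : ℝ) : ℝ :=
  (∏ j ∈ Finset.range t, (1 + y * q ^ s.label π j)) *
    ∏ j ∈ Finset.Ico t n, (1 + z * q ^ s.label π j)

theorem labelProd_diag (q : ℝ) (π : Perm (Fin n)) {t t' : ℕ} (ht : t ≤ n) (ht' : t' ≤ n) (y : ℝ) :
    s.labelProd q π t y y = s.labelProd q π t' y y := by
  unfold labelProd
  rw [Finset.prod_range_mul_prod_Ico _ ht, Finset.prod_range_mul_prod_Ico _ ht']

theorem labelProd_full (q : ℝ) (π : Perm (Fin n)) (y z : ℝ) :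
    s.labelProd q π n y z = s.labelProd q π n y y := by
  simp [labelProd]

theorem labelProd_zero (q : ℝ) (π : Perm (Fin n)) (y z : ℝ) :
    s.labelProd q π 0 y z = s.labelProd q π 0 z z := by
  simp [labelProd]

/-- The sum telescopes, because `(y - w) q ^ d = (1 + y q ^ d) - (1 + w q ^ d)`. -/
theorem sub_mul_sum_labelProd (q : ℝ) (π : Perm (Fin n)) {t : ℕ} (ht : t ≤ n) (y w : ℝ) :
    (y - w) * ∑ g ∈ Finset.Ico t n, q ^ s.label π g *
        ((∏ j ∈ Finset.range g, (1 + y * q ^ s.label π j)) *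
          ∏ j ∈ Finset.Ico (g + 1) n, (1 + w * q ^ s.label π j)) =
      s.labelProd q π n y y - s.labelProd q π t y w := by
  rw [← labelProd_full s q π y w,
    ← Finset.sum_Ico_sub (fun t => s.labelProd q π t y w) ht, Finset.mul_sum]
  refine Finset.sum_congr rfl fun g hg => ?_
  unfold labelProd
  rw [Finset.prod_range_succ, Finset.prod_eq_prod_Ico_succ_bot (Finset.mem_Ico.1 hg).2]
  ring

theorem labelProd_insertLast_last (q : ℝ) (π : Perm (Fin n)) (y z : ℝ) :
    s.labelProd q (insertLast (Fin.last n) π) (n + 1) y z =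
      (1 + y * q ^ n) * s.labelProd q π n y y := by
  have := s.prod_label_le π (Fin.last n) (fun d => 1 + y * q ^ d)
  simp only [Fin.val_last] at this
  simp [labelProd, this]

theorem labelProd_insertLast_castSucc (q : ℝ) (π : Perm (Fin n)) (g : Fin n) (y z : ℝ) :
    s.labelProd q (insertLast g.castSucc π) (g + 1) y z =
      (1 + y * q ^ n) * (1 + z) * ((∏ j ∈ Finset.range g, (1 + y * q ^ s.label π j)) *
          ∏ j ∈ Finset.Ico (g + 1 : ℕ) n, (1 + q * z * q ^ s.label π j)) := by
  have h1 := s.prod_label_le π g.castSucc (fun d => 1 + y * q ^ d)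
  have h2 := s.prod_label_gt π g (fun d => 1 + z * q ^ d)
  simp only [Fin.val_castSucc] at h1
  have h3 : ∀ d, 1 + z * q ^ (d + 1) = 1 + q * z * q ^ d := fun d => by ring
  simp only [h3, pow_zero, mul_one] at h2
  rw [labelProd, h1, h2]
  ring

open Classical in
/-- The generating function of the statistic on a class, refined by the labels; the variable `y`
records the labels of the gaps where the next letter would create a descent of `π`. -/
noncomputable def genFun (P S : Finset ℕ) (n : ℕ) (q y z : ℝ) : ℝ :=
  ∑ π : Perm (Fin n), if InClass P S π then q ^ s.stat π * s.labelProd q π (startGap π) y z else 0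

theorem genFun_zero (P S : Finset ℕ) (q y z : ℝ) : s.genFun P S 0 q y z = 1 := by
  have h : ∀ π : Perm (Fin 0), InClass P S π := fun π => ⟨fun i => i.elim0, fun i => i.elim0⟩
  simp [genFun, h, s.stat_zero, labelProd, startGap]

theorem genFun_succ_of_mem {P S : Finset ℕ} {n : ℕ} (hn : n + 1 ∈ P) (q y z : ℝ) :
    s.genFun P S (n + 1) q y z = (1 + y * q ^ n) * s.genFun P S n q y y := by
  classical
  unfold genFun
  rw [sum_perm_succ, Finset.mul_sum]
  refine Finset.sum_congr rfl fun π _ => ?_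
  by_cases hπ : InClass P S π
  · rw [Fin.sum_univ_castSucc, Finset.sum_eq_zero, zero_add, if_pos hπ, if_pos,
      s.stat_insertLast_last, startGap_insertLast, Fin.val_last, s.labelProd_insertLast_last,
      s.labelProd_diag q π (startGap_le π) le_rfl]
    · ring
    · rw [inClass_insertLast_iff]
      simp [hπ, hn, startGap_le]
    · intro g _
      rw [if_neg]
      rw [inClass_insertLast_iff]
      simp [hn, (Fin.castSucc_lt_last g).ne]
  · simp [inClass_insertLast_iff, hπ]

theorem genFun_succ_of_notMem {P S : Finset ℕ} {n : ℕ} (hn : n + 1 ∉ P) (q y z : ℝ) :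
    (y - q * z) * s.genFun P S (n + 1) q y z = q * (1 + y * q ^ n) * (1 + z) *
      (s.genFun P S n q y y -
        if n ∈ S then s.genFun P S n q (q * z) (q * z) else s.genFun P S n q y (q * z)) := by
  classical
  have hsplit : (if n ∈ S then s.genFun P S n q (q * z) (q * z) else s.genFun P S n q y (q * z)) =
      ∑ π : Perm (Fin n), if InClass P S π then
        q ^ s.stat π * s.labelProd q π (if n ∈ S then 0 else startGap π) y (q * z) else 0 := by
    unfold genFun
    split_ifs with hS
    · simp only [s.labelProd_zero q _ y, s.labelProd_diag q _ (startGap_le _) (Nat.zero_le _)]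
    · rfl
  rw [hsplit]
  unfold genFun
  rw [sum_perm_succ, ← Finset.sum_sub_distrib, Finset.mul_sum, Finset.mul_sum]
  refine Finset.sum_congr rfl fun π _ => ?_
  by_cases hπ : InClass P S π
  · set t := if n ∈ S then 0 else startGap π with ht
    have htn : t ≤ n := by rw [ht]; split_ifs; exacts [Nat.zero_le _, startGap_le π]
    have hcond : ∀ g : Fin n, InClass P S (insertLast g.castSucc π) ↔ t ≤ g.val := by
      intro g
      rw [inClass_insertLast_iff, ht]
      split_ifs with hS <;> simp [hπ, hn, hS, (Fin.castSucc_lt_last g).ne]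
    have hlast : ¬ InClass P S (insertLast (Fin.last n) π) := by
      rw [inClass_insertLast_iff]
      simp [hn]
    rw [Fin.sum_univ_castSucc, if_neg hlast, add_zero, if_pos hπ, if_pos hπ,
      s.labelProd_diag q π (startGap_le π) le_rfl, ← mul_sub, ← s.sub_mul_sum_labelProd q π htn]
    simp only [hcond, s.stat_insertLast_castSucc, startGap_insertLast, Fin.val_castSucc,
      s.labelProd_insertLast_castSucc]
    rw [Fin.sum_univ_eq_sum_range (fun g => if t ≤ g then q ^ (s.stat π + (s.label π g + 1)) *
      ((1 + y * q ^ n) * (1 + z) * ((∏ j ∈ Finset.range g, (1 + y * q ^ s.label π j)) *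
          ∏ j ∈ Finset.Ico (g + 1 : ℕ) n, (1 + q * z * q ^ s.label π j))) else 0) n,
      ← Finset.sum_filter]
    have hIco : (Finset.range n).filter (fun g => t ≤ g) = Finset.Ico t n := by
      ext g; simp [and_comm]
    rw [hIco, Finset.mul_sum, Finset.mul_sum, Finset.mul_sum, Finset.mul_sum]
    refine Finset.sum_congr rfl fun g _ => ?_
    ring
  · simp [inClass_insertLast_iff, hπ]

/-- The recursions for `genFun` do not involve the statistic any more. They determine `genFun` as
long as `y ≠ q z`, and the condition `0 < y ≤ z` is inherited by the arguments on their right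
sides. -/
theorem genFun_eq (s' : InsertionStatistic) (P S : Finset ℕ) (n : ℕ) {q : ℝ} (hq : 1 < q)
    {y z : ℝ} (hy : 0 < y) (hyz : y ≤ z) : s.genFun P S n q y z = s'.genFun P S n q y z := by
  induction n generalizing y z with
  | zero => rw [genFun_zero, genFun_zero]
  | succ n ih =>
    by_cases hn : n + 1 ∈ P
    · rw [genFun_succ_of_mem s hn, genFun_succ_of_mem s' hn, ih hy le_rfl]
    · have hlt : z < q * z := by nlinarith
      refine mul_left_cancel₀ (sub_neg.2 (hyz.trans_lt hlt)).ne ?_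
      rw [genFun_succ_of_notMem s hn, genFun_succ_of_notMem s' hn, ih hy le_rfl,
        ih hy (hyz.trans hlt.le), ih (y := q * z) (by linarith) le_rfl]

theorem continuous_genFun_diag (P S : Finset ℕ) (n : ℕ) (q : ℝ) :
    Continuous fun y => s.genFun P S n q y y := by
  classical
  unfold genFun labelProd
  refine continuous_finsetSum _ fun π _ => ?_
  split_ifs
  · fun_prop
  · exact continuous_const

theorem genFun_zero_zero (P S : Finset ℕ) {n : ℕ} (hP : P ⊆ Finset.Icc 1 n) (q : ℝ) :
    s.genFun P S n q 0 0 = (genPoly (descSubset n P S) s.stat).aeval q := by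
  classical
  unfold genFun genPoly labelProd
  simp only [map_sum, map_pow, Polynomial.aeval_X, zero_mul, add_zero, Finset.prod_const_one,
    mul_one]
  rw [← Finset.sum_filter]
  refine Finset.sum_congr ?_ fun _ _ => rfl
  ext π
  simp [mem_descSubset_iff hP]

theorem genPoly_eq (s' : InsertionStatistic) {P : Finset ℕ} (S : Finset ℕ) {n : ℕ}
    (hP : P ⊆ Finset.Icc 1 n) :
    genPoly (descSubset n P S) s.stat = genPoly (descSubset n P S) s'.stat := by
  have key : ∀ q : ℝ, 1 < q → s.genFun P S n q 0 0 = s'.genFun P S n q 0 0 := by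
    intro q hq
    have hclosed : IsClosed {y : ℝ | s.genFun P S n q y y = s'.genFun P S n q y y} :=
      isClosed_eq (s.continuous_genFun_diag P S n q) (s'.continuous_genFun_diag P S n q)
    have hsub : Set.Ioi (0 : ℝ) ⊆ {y : ℝ | s.genFun P S n q y y = s'.genFun P S n q y y} :=
      fun y hy => s.genFun_eq s' P S n hq hy le_rfl
    have := closure_minimal hsub hclosed
    rw [closure_Ioi] at this
    exact this (Set.mem_Ici.2 le_rfl)
  refine Polynomial.map_injective (Int.castRingHom ℝ) Int.cast_injective ?_
  refine Polynomial.eq_of_infinite_eval_eq _ _ ((Set.Ioi_infinite (1 : ℝ)).mono fun q hq => ?_)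
  have := key q hq
  rw [s.genFun_zero_zero P S hP, s'.genFun_zero_zero P S hP] at this
  simpa [Polynomial.aeval_def, Polynomial.eval_map] using this

end InsertionStatistic

/-! ### Inversions as an insertion statistic -/

theorem inv_insertLast {n : ℕ} (g : Fin (n + 1)) (π : Perm (Fin n)) :
    inv (insertLast g π) = inv π + (n - g) := by
  have hsum : ∀ {m : ℕ} (ρ : Perm (Fin m)),
      inv ρ = ∑ i, ∑ j, if i < j ∧ ρ j < ρ i then 1 else 0 := by
    intro m ρ
    rw [inv, Finset.card_filter, Fintype.sum_prod_type]
  have hcard : ∑ v : Fin n, (if g ≤ v.castSucc then 1 else 0) = n - g.val := by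
    simp only [Fin.le_def, Fin.val_castSucc]
    rw [Fin.sum_univ_eq_sum_range (fun v => if g.val ≤ v then 1 else 0) n, ← Finset.card_filter]
    have : (Finset.range n).filter (fun v => g.val ≤ v) = Finset.Ico g.val n := by
      ext v; simp [and_comm]
    rw [this, Nat.card_Ico]
  rw [hsum, hsum, Fin.sum_univ_castSucc]
  have hlast : ∀ j, ¬ (Fin.last n < j ∧ insertLast g π j < insertLast g π (Fin.last n)) :=
    fun j h => h.1.not_ge (Fin.le_last j)
  simp only [hlast, if_false, Finset.sum_const_zero, add_zero]
  simp only [Fin.sum_univ_castSucc, Finset.sum_add_distrib, insertLast_castSucc, insertLast_last,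
    Fin.castSucc_lt_castSucc_iff, Fin.succAbove_lt_succAbove_iff, Fin.castSucc_lt_last, true_and,
    Fin.lt_succAbove_iff_le_castSucc]
  rw [Equiv.sum_comp π (fun v => if g ≤ v.castSucc then 1 else 0), hcard]

/-- The inversion number is an insertion statistic, with the labels `n - 1, …, 1, 0`. -/
def invInsertion : InsertionStatistic where
  stat := inv
  label {n} _ j := n - 1 - j
  stat_zero π := by simp [inv]
  stat_insertLast_last π := by simp [inv_insertLast]
  stat_insertLast_castSucc π g := by
    rw [inv_insertLast, Fin.val_castSucc]
    omega
  prod_label_le {n} π g F := by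
    rw [Finset.prod_range_succ', mul_comm]
    congr 1
    refine Finset.prod_congr rfl fun j _ => ?_
    congr 1
    omega
  prod_label_gt {n} π g F := by
    rw [Finset.prod_Ico_succ_top (by omega), mul_comm]
    congr 1
    · congr 1
      omega
    · refine Finset.prod_congr rfl fun j hj => ?_
      have := Finset.mem_Ico.1 hj
      congr 1
      omega

/-! ### Words and insertion of a largest letter -/

/-- The word `π⁻¹` with letters `0, …, n - 1`, as a function on `ℕ` that vanishes beyond `n`. -/
def word {n : ℕ} (π : Perm (Fin n)) (i : ℕ) : ℕ := if h : i < n then (π⁻¹ ⟨i, h⟩).val else 0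

theorem word_lt {n : ℕ} (π : Perm (Fin n)) {i : ℕ} (h : i < n) : word π i < n := by
  rw [word, dif_pos h]
  exact Fin.isLt _

/-- Insertion of the letter `x` into the word `w` at position `g`. -/
def insertLetter (g x : ℕ) (w : ℕ → ℕ) (i : ℕ) : ℕ :=
  if i < g then w i else if i = g then x else w (i - 1)

theorem word_insertLast {n : ℕ} (g : Fin (n + 1)) (π : Perm (Fin n)) :
    word (insertLast g π) = insertLetter g n (word π) := by
  funext i
  unfold insertLetter word
  rcases lt_trichotomy i g.val with h | h | h
  · have hn : i < n := by omega
    have : (⟨i, by omega⟩ : Fin (n + 1)) = g.succAbove ⟨i, hn⟩ := by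
      rw [Fin.succAbove_of_castSucc_lt _ _ (by rw [Fin.lt_def]; exact h)]
      rfl
    rw [dif_pos (by omega), if_pos h, dif_pos hn, this, insertLast_inv_succAbove, Fin.val_castSucc]
  · rw [dif_pos (by omega), if_neg (by omega), if_pos h]
    have : (⟨i, by omega⟩ : Fin (n + 1)) = g := Fin.ext h
    rw [this, insertLast_inv_self, Fin.val_last]
  · rw [if_neg (by omega), if_neg (by omega)]
    by_cases hi : i < n + 1
    · have : (⟨i, hi⟩ : Fin (n + 1)) = g.succAbove ⟨i - 1, by omega⟩ := by
        rw [Fin.succAbove_of_le_castSucc _ _ (by rw [Fin.le_def]; simp only [Fin.val_castSucc]; omega)]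
        ext
        simp only [Fin.val_succ]
        omega
      rw [dif_pos hi, dif_pos (by omega), this, insertLast_inv_succAbove, Fin.val_castSucc]
    · rw [dif_neg hi, dif_neg (by omega)]

section

variable {n g x : ℕ} {w : ℕ → ℕ}

theorem insertLetter_lt {i : ℕ} (h : i < g) : insertLetter g x w i = w i := by
  simp [insertLetter, h]

theorem insertLetter_self : insertLetter g x w g = x := by
  simp [insertLetter]

theorem insertLetter_succ {i : ℕ} (h : g ≤ i) : insertLetter g x w (i + 1) = w i := by
  simp [insertLetter, show ¬ i + 1 < g by omega, show i + 1 ≠ g by omega]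

theorem sum_Ico_insertLetter_of_le (F : ℕ → ℕ) {a : ℕ} (ha : g ≤ a) :
    ∑ i ∈ Finset.Ico (a + 1) (n + 1), F (insertLetter g x w i) =
      ∑ i ∈ Finset.Ico a n, F (w i) := by
  rw [← Finset.sum_Ico_add' (fun i => F (insertLetter g x w i)) a n 1]
  exact Finset.sum_congr rfl fun i hi => by
    rw [insertLetter_succ (ha.trans (Finset.mem_Ico.1 hi).1)]

theorem sum_Ico_insertLetter (F : ℕ → ℕ) {a : ℕ} (ha : a ≤ g) (hg : g ≤ n) :
    ∑ i ∈ Finset.Ico a (n + 1), F (insertLetter g x w i) =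
      F x + ∑ i ∈ Finset.Ico a n, F (w i) := by
  rw [← Finset.sum_Ico_consecutive _ ha (by omega : g ≤ n + 1),
    Finset.sum_eq_sum_Ico_succ_bot (by omega : g < n + 1), sum_Ico_insertLetter_of_le F le_rfl,
    insertLetter_self, ← Finset.sum_Ico_consecutive _ ha hg, add_left_comm]
  congr 2
  exact Finset.sum_congr rfl fun i hi => by rw [insertLetter_lt (Finset.mem_Ico.1 hi).2]

end

/-! ### The statistic `mak` as an insertion statistic -/

/-- The number of letters to the right of position `g` that are smaller than the letter there. -/
def rightSmaller (n : ℕ) (w : ℕ → ℕ) (g : ℕ) : ℕ :=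
  ∑ i ∈ Finset.Ico (g + 1) n, if w i < w g then 1 else 0

/-- The contribution to `mak` of the positions `g - 1` and `g`: if there is a descent, the number
of letters up to position `g - 1` that are at most as large as the letter there, plus the number
of letters after position `g` that are smaller than the letter there. -/
def descentWeight (n : ℕ) (w : ℕ → ℕ) (g : ℕ) : ℕ :=
  if 0 < g ∧ w g < w (g - 1) then
    (∑ i ∈ Finset.Ico 0 g, if w i ≤ w (g - 1) then 1 else 0) + rightSmaller n w g
  else 0

/-- The label of position `g` for `mak`; `g + 1 + rightSmaller n w g` is the weight of the descent
created by inserting a largest letter before position `g`, and `descentWeight n w g` that of the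
descent which this insertion may destroy. -/
def makLabel (n : ℕ) (w : ℕ → ℕ) (g : ℕ) : ℕ :=
  g + rightSmaller n w g - descentWeight n w g

theorem descentWeight_le (n : ℕ) (w : ℕ → ℕ) (g : ℕ) :
    descentWeight n w g ≤ g + rightSmaller n w g := by
  unfold descentWeight
  split_ifs
  · refine Nat.add_le_add_right ?_ _
    rw [← Finset.card_filter]
    exact (Finset.card_filter_le _ _).trans (by simp)
  · exact Nat.zero_le _

section

variable {n g : ℕ} {w : ℕ → ℕ}

theorem rightSmaller_insertLetter_lt (hw : ∀ i < n, w i < n) (hg : g ≤ n) {j : ℕ} (hj : j < g) :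
    rightSmaller (n + 1) (insertLetter g n w) j = rightSmaller n w j := by
  unfold rightSmaller
  rw [insertLetter_lt hj, sum_Ico_insertLetter (fun v => if v < w j then 1 else 0) hj hg,
    if_neg (hw j (by omega)).not_gt, zero_add]

theorem rightSmaller_insertLetter_self (hw : ∀ i < n, w i < n) :
    rightSmaller (n + 1) (insertLetter g n w) g = n - g := by
  unfold rightSmaller
  rw [insertLetter_self, sum_Ico_insertLetter_of_le (fun v => if v < n then 1 else 0) le_rfl,
    Finset.sum_congr rfl (fun i hi => if_pos (hw i (Finset.mem_Ico.1 hi).2))]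
  simp

theorem rightSmaller_insertLetter_succ {j : ℕ} (hj : g ≤ j) :
    rightSmaller (n + 1) (insertLetter g n w) (j + 1) = rightSmaller n w j := by
  unfold rightSmaller
  rw [insertLetter_succ hj,
    sum_Ico_insertLetter_of_le (fun v => if v < w j then 1 else 0) (by omega)]

theorem descentWeight_insertLetter_lt (hw : ∀ i < n, w i < n) (hg : g ≤ n) {j : ℕ} (hj : j < g) :
    descentWeight (n + 1) (insertLetter g n w) j = descentWeight n w j := by
  unfold descentWeight
  rw [rightSmaller_insertLetter_lt hw hg hj, insertLetter_lt hj,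
    insertLetter_lt (by omega : j - 1 < g)]
  congr 2
  refine Finset.sum_congr rfl fun i hi => ?_
  rw [insertLetter_lt ((Finset.mem_Ico.1 hi).2.trans hj)]

theorem descentWeight_insertLetter_self (hw : ∀ i < n, w i < n) (hg : g ≤ n) :
    descentWeight (n + 1) (insertLetter g n w) g = 0 := by
  unfold descentWeight
  refine if_neg fun h => ?_
  have h1 := h.2
  rw [insertLetter_self, insertLetter_lt (by omega)] at h1
  exact h1.not_gt (hw _ (by omega))

theorem descentWeight_insertLetter_succ_self (hw : ∀ i < n, w i < n) (hg : g < n) :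
    descentWeight (n + 1) (insertLetter g n w) (g + 1) = g + 1 + rightSmaller n w g := by
  unfold descentWeight
  rw [rightSmaller_insertLetter_succ le_rfl, Nat.add_sub_cancel, insertLetter_self,
    insertLetter_succ le_rfl, if_pos ⟨Nat.succ_pos g, hw g hg⟩,
    sum_Ico_insertLetter (fun v => if v ≤ n then 1 else 0) (Nat.zero_le g) le_rfl, if_pos le_rfl,
    Finset.sum_congr rfl (fun i hi => if_pos (hw i ((Finset.mem_Ico.1 hi).2.trans hg)).le)]
  simp [add_comm]

theorem descentWeight_insertLetter_succ (hw : ∀ i < n, w i < n) {j : ℕ} (hj : g < j)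
    (hjn : j < n) : descentWeight (n + 1) (insertLetter g n w) (j + 1) = descentWeight n w j := by
  have h1 : insertLetter g n w j = w (j - 1) := by
    obtain ⟨j, rfl⟩ : ∃ k, j = k + 1 := ⟨j - 1, by omega⟩
    rw [insertLetter_succ (by omega), Nat.add_sub_cancel]
  unfold descentWeight
  rw [rightSmaller_insertLetter_succ hj.le, Nat.add_sub_cancel, insertLetter_succ hj.le, h1,
    sum_Ico_insertLetter (fun v => if v ≤ w (j - 1) then 1 else 0) (Nat.zero_le g) hj.le,
    if_neg (hw (j - 1) (by omega)).not_ge, zero_add]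
  refine if_congr ?_ rfl rfl
  simp [show 0 < j by omega]

theorem sum_descentWeight_insertLetter_last (hw : ∀ i < n, w i < n) :
    ∑ j ∈ Finset.range (n + 1), descentWeight (n + 1) (insertLetter n n w) j =
      ∑ j ∈ Finset.range n, descentWeight n w j := by
  rw [Finset.sum_range_succ, descentWeight_insertLetter_self hw le_rfl, add_zero]
  exact Finset.sum_congr rfl fun j hj =>
    descentWeight_insertLetter_lt hw le_rfl (Finset.mem_range.1 hj)

theorem sum_descentWeight_insertLetter (hw : ∀ i < n, w i < n) (hg : g < n) :
    ∑ j ∈ Finset.range (n + 1), descentWeight (n + 1) (insertLetter g n w) j =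
      ∑ j ∈ Finset.range n, descentWeight n w j + (makLabel n w g + 1) := by
  have hle := descentWeight_le n w g
  have h1 : ∑ j ∈ Finset.Ico 0 g, descentWeight (n + 1) (insertLetter g n w) j =
      ∑ j ∈ Finset.Ico 0 g, descentWeight n w j :=
    Finset.sum_congr rfl fun j hj =>
      descentWeight_insertLetter_lt hw hg.le (Finset.mem_Ico.1 hj).2
  have h2 : ∑ j ∈ Finset.Ico (g + 2) (n + 1), descentWeight (n + 1) (insertLetter g n w) j =
      ∑ j ∈ Finset.Ico (g + 1) n, descentWeight n w j := by
    rw [← Finset.sum_Ico_add' _ (g + 1) n 1]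
    exact Finset.sum_congr rfl fun j hj =>
      descentWeight_insertLetter_succ hw (Finset.mem_Ico.1 hj).1 (Finset.mem_Ico.1 hj).2
  rw [Finset.range_eq_Ico, Finset.range_eq_Ico,
    ← Finset.sum_Ico_consecutive _ (Nat.zero_le g) (by omega : g ≤ n + 1),
    ← Finset.sum_Ico_consecutive _ (Nat.zero_le g) hg.le,
    Finset.sum_eq_sum_Ico_succ_bot (by omega : g < n + 1),
    Finset.sum_eq_sum_Ico_succ_bot (by omega : g + 1 < n + 1),
    Finset.sum_eq_sum_Ico_succ_bot hg, h1, h2, descentWeight_insertLetter_self hw hg.le,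
    descentWeight_insertLetter_succ_self hw hg]
  unfold makLabel
  omega

theorem makLabel_insertLetter_lt (hw : ∀ i < n, w i < n) (hg : g ≤ n) {j : ℕ} (hj : j < g) :
    makLabel (n + 1) (insertLetter g n w) j = makLabel n w j := by
  unfold makLabel
  rw [rightSmaller_insertLetter_lt hw hg hj, descentWeight_insertLetter_lt hw hg hj]

theorem makLabel_insertLetter_self (hw : ∀ i < n, w i < n) (hg : g ≤ n) :
    makLabel (n + 1) (insertLetter g n w) g = n := by
  unfold makLabel
  rw [rightSmaller_insertLetter_self hw, descentWeight_insertLetter_self hw hg]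
  omega

theorem makLabel_insertLetter_succ_self (hw : ∀ i < n, w i < n) (hg : g < n) :
    makLabel (n + 1) (insertLetter g n w) (g + 1) = 0 := by
  unfold makLabel
  rw [rightSmaller_insertLetter_succ le_rfl, descentWeight_insertLetter_succ_self hw hg,
    Nat.sub_self]

theorem makLabel_insertLetter_succ (hw : ∀ i < n, w i < n) {j : ℕ} (hj : g < j) (hjn : j < n) :
    makLabel (n + 1) (insertLetter g n w) (j + 1) = makLabel n w j + 1 := by
  have hle := descentWeight_le n w j
  unfold makLabel
  rw [rightSmaller_insertLetter_succ hj.le, descentWeight_insertLetter_succ hw hj hjn]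
  omega

end

/-- The sum of the descent weights of the word `π⁻¹` is an insertion statistic. -/
def makInsertion : InsertionStatistic where
  stat {n} π := ∑ j ∈ Finset.range n, descentWeight n (word π) j
  label {n} π j := makLabel n (word π) j
  stat_zero π := by simp
  stat_insertLast_last π := by
    rw [word_insertLast, Fin.val_last, sum_descentWeight_insertLetter_last fun i => word_lt π]
  stat_insertLast_castSucc π g := by
    rw [word_insertLast, Fin.val_castSucc, sum_descentWeight_insertLetter (fun i => word_lt π) g.2]
  prod_label_le {n} π g F := by
    have hg : g.val ≤ n := Nat.lt_succ_iff.1 g.2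
    rw [Finset.prod_range_succ, word_insertLast, makLabel_insertLetter_self (fun i => word_lt π) hg,
      mul_comm]
    congr 1
    refine Finset.prod_congr rfl fun j hj => ?_
    rw [makLabel_insertLetter_lt (fun i => word_lt π) hg (Finset.mem_range.1 hj)]
  prod_label_gt {n} π g F := by
    rw [Finset.prod_eq_prod_Ico_succ_bot (by omega), word_insertLast, Fin.val_castSucc,
      makLabel_insertLetter_succ_self (fun i => word_lt π) g.2]
    congr 1
    rw [← Finset.prod_Ico_add' _ (g.val + 1) n 1]
    refine Finset.prod_congr rfl fun j hj => ?_
    rw [makLabel_insertLetter_succ (fun i => word_lt π) (Finset.mem_Ico.1 hj).1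
      (Finset.mem_Ico.1 hj).2]

/-! ### Embracing numbers through descents -/

theorem exists_step_of_not {Q : ℕ → Prop} {a b : ℕ} (hab : a ≤ b) (ha : Q a) (hb : ¬ Q b) :
    ∃ k, a ≤ k ∧ k < b ∧ Q k ∧ ¬ Q (k + 1) := by
  induction b, hab using Nat.le_induction with
  | base => exact absurd ha hb
  | succ b hab ih =>
    by_cases h : Q b
    · exact ⟨b, hab, Nat.lt_succ_self b, h, hb⟩
    · obtain ⟨k, h1, h2, h3⟩ := ih h
      exact ⟨k, h1, by omega, h3⟩

section

variable {n : ℕ} {σ : Perm (Fin n)}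

theorem lt_of_consecutive_lt {a b : Fin n}
    (h : ∀ i j : Fin n, a ≤ i → j ≤ b → j.val = i.val + 1 → σ j < σ i) {x y : Fin n}
    (hax : a ≤ x) (hxy : x < y) (hyb : y ≤ b) : σ y < σ x := by
  obtain ⟨y, hy⟩ := y
  simp only [Fin.lt_def, Fin.le_def] at *
  induction y, (hxy : x.val + 1 ≤ y) using Nat.le_induction with
  | base => exact h x _ hax hyb rfl
  | succ y hle ih =>
    exact (h ⟨y, by omega⟩ ⟨y + 1, hy⟩ (by simp only; omega) hyb rfl).trans
      (ih (by omega) (by omega))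

theorem IsProperDescentBlock.eq_of_common_descent {a b a' b' i j : Fin n}
    (h : IsProperDescentBlock σ a b) (h' : IsProperDescentBlock σ a' b') (hij : i < j)
    (hai : a ≤ i) (hjb : j ≤ b) (hai' : a' ≤ i) (hjb' : j ≤ b') : a = a' ∧ b = b' := by
  obtain ⟨-, h2, h3, h4⟩ := h
  obtain ⟨-, h2', h3', h4'⟩ := h'
  simp only [Fin.lt_def, Fin.le_def] at hij hai hjb hai' hjb'
  constructor
  · rcases lt_trichotomy a a' with hlt | heq | hlt
    · rw [Fin.lt_def] at hlt
      exact absurd ⟨⟨a'.val - 1, by omega⟩, by simp only; omega,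
        h2 _ _ (by rw [Fin.le_def]; simp only; omega) (by rw [Fin.le_def]; omega)
          (by simp only; omega)⟩ h3'
    · exact heq
    · rw [Fin.lt_def] at hlt
      exact absurd ⟨⟨a.val - 1, by omega⟩, by simp only; omega,
        h2' _ _ (by rw [Fin.le_def]; simp only; omega) (by rw [Fin.le_def]; omega)
          (by simp only; omega)⟩ h3
  · rcases lt_trichotomy b b' with hlt | heq | hlt
    · rw [Fin.lt_def] at hlt
      exact absurd ⟨⟨b.val + 1, by omega⟩, rfl,
        h2' _ _ (by rw [Fin.le_def]; omega) (by rw [Fin.le_def]; simp only; omega) rfl⟩ h4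
    · exact heq
    · rw [Fin.lt_def] at hlt
      exact absurd ⟨⟨b'.val + 1, by omega⟩, rfl,
        h2 _ _ (by rw [Fin.le_def]; omega) (by rw [Fin.le_def]; simp only; omega) rfl⟩ h4'

theorem IsDescentPair.exists_block {i j : Fin n} (h : IsDescentPair σ i j) :
    ∃ a b, IsProperDescentBlock σ a b ∧ a ≤ i ∧ j ≤ b := by
  obtain ⟨hij, hσ⟩ := h
  obtain ⟨a, ⟨hai, ha⟩, hamin⟩ := wellFounded_lt.has_min
    {a : Fin n | a ≤ i ∧ ∀ x y : Fin n, a ≤ x → y ≤ j → y.val = x.val + 1 → σ y < σ x}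
    ⟨i, le_rfl, fun x y hx hy hxy => by
      rw [Fin.le_def] at hx hy
      obtain rfl : x = i := Fin.ext (by omega)
      obtain rfl : y = j := Fin.ext (by omega)
      exact hσ⟩
  obtain ⟨b, ⟨hjb, hb⟩, hbmax⟩ := wellFounded_gt.has_min
    {b : Fin n | j ≤ b ∧ ∀ x y : Fin n, i ≤ x → y ≤ b → y.val = x.val + 1 → σ y < σ x}
    ⟨j, le_rfl, fun x y hx hy hxy => by
      rw [Fin.le_def] at hx hy
      obtain rfl : x = i := Fin.ext (by omega)
      obtain rfl : y = j := Fin.ext (by omega)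
      exact hσ⟩
  refine ⟨a, b, ⟨?_, ?_, ?_, ?_⟩, hai, hjb⟩
  · rw [Fin.lt_def]; rw [Fin.le_def] at hai hjb; omega
  · intro x y hx hy hxy
    by_cases hyj : y ≤ j
    · exact ha x y hx hyj hxy
    · refine hb x y ?_ hy hxy
      rw [Fin.le_def] at hyj ⊢
      omega
  · rintro ⟨c, hc, hσc⟩
    refine hamin c ⟨?_, fun x y hx hy hxy => ?_⟩ ?_
    · rw [Fin.le_def] at hai ⊢; omega
    · rcases hx.eq_or_lt with rfl | hx
      · obtain rfl : y = a := Fin.ext (by omega)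
        exact hσc
      · refine ha x y ?_ hy hxy
        rw [Fin.lt_def] at hx; rw [Fin.le_def]; omega
    · rw [Fin.lt_def]; omega
  · rintro ⟨c, hc, hσc⟩
    refine hbmax c ⟨?_, fun x y hx hy hxy => ?_⟩ ?_
    · rw [Fin.le_def] at hjb ⊢; omega
    · rcases hy.eq_or_lt with rfl | hy
      · obtain rfl : x = b := Fin.ext (by omega)
        exact hσc
      · refine hb x y hx ?_ hxy
        rw [Fin.lt_def] at hy; rw [Fin.le_def]; omega
    · show b < c
      rw [Fin.lt_def]; omega

/-- A block embraces the letter at position `i` on its left exactly if one of its descents crosses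
that letter, and then exactly one does. -/
theorem embracingNumber_eq (σ : Perm (Fin n)) (i : Fin n) :
    embracingNumber σ i = (Finset.univ.filter fun p : Fin n × Fin n =>
      IsDescentPair σ p.1 p.2 ∧ i < p.1 ∧ σ p.2 < σ i ∧ σ i < σ p.1).card := by
  classical
  unfold embracingNumber
  have := Finset.card_mul_eq_card_mul (m := 1) (n := 1)
    (s := Finset.univ.filter fun B : Fin n × Fin n =>
      IsProperDescentBlock σ B.1 B.2 ∧ i < B.1 ∧ σ i ≤ σ B.1 ∧ σ B.2 < σ i)
    (t := Finset.univ.filter fun p : Fin n × Fin n =>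
      IsDescentPair σ p.1 p.2 ∧ i < p.1 ∧ σ p.2 < σ i ∧ σ i < σ p.1)
    (fun B p => B.1 ≤ p.1 ∧ p.2 ≤ B.2) ?_ ?_
  · simpa using this
  · rintro ⟨a, b⟩ hB
    simp only [Finset.mem_filter, Finset.mem_univ, true_and] at hB
    obtain ⟨⟨hab, hrun, -, -⟩, hia, hσa, hσb⟩ := hB
    have hσa' : σ i < σ a := lt_of_le_of_ne hσa fun h => hia.ne (σ.injective h)
    obtain ⟨k, hak, hkb, ⟨hk, hik⟩, hnot⟩ := exists_step_of_not
      (Q := fun k => ∃ h : k < n, σ i < σ ⟨k, h⟩) (a := a.val) (b := b.val) hab.le ⟨a.2, hσa'⟩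
      (fun ⟨_, h⟩ => h.not_gt hσb)
    have hk1 : k + 1 < n := by omega
    have hle : σ ⟨k + 1, hk1⟩ ≤ σ i := not_lt.1 fun h => hnot ⟨hk1, h⟩
    have hne : σ ⟨k + 1, hk1⟩ ≠ σ i := fun h => by
      have := congrArg Fin.val (σ.injective h)
      rw [Fin.lt_def] at hia
      simp only at this
      omega
    rw [Finset.card_eq_one]
    refine ⟨(⟨k, hk⟩, ⟨k + 1, hk1⟩), ?_⟩
    ext ⟨x, y⟩
    simp only [Finset.bipartiteAbove, Finset.mem_filter, Finset.mem_univ, true_and,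
      Finset.mem_singleton, Prod.mk.injEq]
    constructor
    · rintro ⟨⟨⟨hxy, -⟩, hix, hyi, hxi⟩, hax, hyb⟩
      rw [Fin.le_def] at hax hyb
      have hxk : x.val = k := by
        rcases lt_trichotomy x.val k with hlt | heq | hlt
        · exfalso
          rcases eq_or_ne y.val k with heq | hne
          · obtain rfl : y = ⟨k, hk⟩ := Fin.ext heq
            exact hyi.not_gt hik
          · exact (hyi.trans hik).not_gt (lt_of_consecutive_lt hrun (by rw [Fin.le_def]; omega)
              (by rw [Fin.lt_def]; simp only; omega) (by rw [Fin.le_def]; exact hkb.le))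
        · exact heq
        · exfalso
          rcases eq_or_ne x.val (k + 1) with heq | hne
          · obtain rfl : x = ⟨k + 1, hk1⟩ := Fin.ext heq
            exact hle.not_gt hxi
          · exact (hle.trans_lt hxi).not_gt (lt_of_consecutive_lt hrun
              (by rw [Fin.le_def]; simp only; omega)
              (by rw [Fin.lt_def]; simp only; omega) (by rw [Fin.le_def]; omega))
      exact ⟨Fin.ext hxk, Fin.ext (by simp only; omega)⟩
    · rintro ⟨rfl, rfl⟩
      refine ⟨⟨⟨rfl, hle.trans_lt hik⟩, ?_, lt_of_le_of_ne hle hne, hik⟩, ?_, ?_⟩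
      · rw [Fin.lt_def] at hia ⊢; simp only; omega
      · rw [Fin.le_def]; exact hak
      · rw [Fin.le_def]; exact hkb
  · rintro ⟨x, y⟩ hp
    simp only [Finset.mem_filter, Finset.mem_univ, true_and] at hp
    obtain ⟨hd, hix, hyi, hxi⟩ := hp
    obtain ⟨a, b, hB, hax, hyb⟩ := hd.exists_block
    have hxy : x < y := by have := hd.1; rw [Fin.lt_def]; omega
    rw [Finset.card_eq_one]
    refine ⟨(a, b), ?_⟩
    ext ⟨a', b'⟩
    simp only [Finset.bipartiteBelow, Finset.mem_filter, Finset.mem_univ, true_and,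
      Finset.mem_singleton, Prod.mk.injEq]
    constructor
    · rintro ⟨⟨hB', -⟩, hax', hyb'⟩
      exact hB'.eq_of_common_descent hB hxy hax' hyb' hax hyb
    · rintro ⟨rfl, rfl⟩
      refine ⟨⟨hB, ?_, ?_, ?_⟩, hax, hyb⟩
      · by_contra hia
        exact hxi.not_gt (lt_of_consecutive_lt hB.2.1 (not_lt.1 hia) hix (hxy.le.trans hyb))
      · rcases hax.eq_or_lt with rfl | hlt
        · exact hxi.le
        · exact hxi.le.trans (lt_of_consecutive_lt hB.2.1 le_rfl hlt (hxy.le.trans hyb)).le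
      · rcases hyb.eq_or_lt with rfl | hlt
        · exact hyi
        · exact (lt_of_consecutive_lt hB.2.1 (hax.trans hxy.le) hlt le_rfl).trans hyi

theorem mak_eq_sum (σ : Perm (Fin n)) :
    mak σ = ∑ p ∈ Finset.univ.filter (fun p : Fin n × Fin n => IsDescentPair σ p.1 p.2),
      ((σ p.2).val + 1 + ∑ i : Fin n, if i < p.1 ∧ σ p.2 < σ i ∧ σ i < σ p.1 then 1 else 0) := by
  rw [Finset.sum_add_distrib, Finset.sum_comm, mak, Dbot, Res]
  congr 1
  refine Finset.sum_congr rfl fun i _ => ?_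
  rw [embracingNumber_eq, ← Finset.filter_filter, Finset.card_filter]

theorem val_apply_eq_sum (σ : Perm (Fin n)) (j : Fin n) :
    (σ j).val = ∑ i : Fin n, if σ i < σ j then 1 else 0 := by
  rw [Equiv.sum_comp σ (fun v => if v < σ j then 1 else 0), ← Finset.card_filter]
  have : Finset.univ.filter (fun v : Fin n => v < σ j) = Finset.Iio (σ j) := by ext; simp
  rw [this, Fin.card_Iio]

end

theorem imak_eq {n : ℕ} (π : Perm (Fin n)) :
    imak π = ∑ j ∈ Finset.range n, descentWeight n (word π) j := by
  have hword : ∀ i : Fin n, word π i.val = (π⁻¹ i).val := fun i => dif_pos i.2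
  rw [imak, mak_eq_sum]
  unfold descentWeight
  rw [← Finset.sum_filter]
  refine Finset.sum_bij (fun p _ => p.2.val) ?_ ?_ ?_ ?_
  · rintro ⟨i, j⟩ h
    simp only [Finset.mem_filter, Finset.mem_univ, true_and, Finset.mem_range] at h ⊢
    have hi : j.val - 1 = i.val := by have := h.1; omega
    refine ⟨j.2, by have := h.1; omega, ?_⟩
    rw [hi, hword, hword]
    exact h.2
  · rintro ⟨i, j⟩ h ⟨i', j'⟩ h' e
    simp only [Finset.mem_filter, Finset.mem_univ, true_and] at h h' e
    obtain rfl : j = j' := Fin.ext e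
    have := h.1
    have := h'.1
    rw [show i = i' from Fin.ext (by omega)]
  · intro g hg
    simp only [Finset.mem_filter, Finset.mem_range] at hg
    obtain ⟨hgn, hg0, hlt⟩ := hg
    refine ⟨(⟨g - 1, by omega⟩, ⟨g, hgn⟩), ?_, rfl⟩
    simp only [Finset.mem_filter, Finset.mem_univ, true_and]
    refine ⟨by simp only; omega, ?_⟩
    have h1 := hword ⟨g - 1, by omega⟩
    have h2 := hword ⟨g, hgn⟩
    simp only at h1 h2
    rw [h1, h2] at hlt
    exact hlt
  · rintro ⟨k, l⟩ h
    simp only [Finset.mem_filter, Finset.mem_univ, true_and] at h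
    obtain ⟨hkl, hlt⟩ := h
    have hk : l.val - 1 = k.val := by omega
    simp only [rightSmaller, hk]
    have hleft : (∑ i ∈ Finset.Ico 0 l.val, if word π i ≤ word π k.val then 1 else 0) =
        ∑ i : Fin n, if i < l ∧ π⁻¹ i ≤ π⁻¹ k then 1 else 0 := by
      simp only [Fin.le_def, Fin.lt_def, ← hword]
      rw [Fin.sum_univ_eq_sum_range (fun i => if i < l.val ∧ word π i ≤ word π k.val then 1 else 0),
        ← Finset.card_filter, ← Finset.card_filter]
      congr 1
      ext i
      simp only [Finset.mem_filter, Finset.mem_Ico, Finset.mem_range]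
      omega
    have hright : (∑ i ∈ Finset.Ico (l.val + 1) n, if word π i < word π l.val then 1 else 0) =
        ∑ i : Fin n, if l < i ∧ π⁻¹ i < π⁻¹ l then 1 else 0 := by
      simp only [Fin.lt_def, ← hword]
      rw [Fin.sum_univ_eq_sum_range (fun i => if l.val < i ∧ word π i < word π l.val then 1 else 0),
        ← Finset.card_filter, ← Finset.card_filter]
      congr 1
      ext i
      simp only [Finset.mem_filter, Finset.mem_Ico, Finset.mem_range]
      omega
    have hpt : ∀ i : Fin n, ((if i < l ∧ π⁻¹ i ≤ π⁻¹ k then 1 else 0) +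
        if l < i ∧ π⁻¹ i < π⁻¹ l then 1 else 0) = (if π⁻¹ i < π⁻¹ l then 1 else 0) +
        ((if i = k then 1 else 0) + if i < k ∧ π⁻¹ l < π⁻¹ i ∧ π⁻¹ i < π⁻¹ k then 1 else 0) := by
      intro i
      have h1 : (π⁻¹ i).val = (π⁻¹ l).val ↔ i.val = l.val := by
        rw [← Fin.ext_iff, π⁻¹.injective.eq_iff, Fin.ext_iff]
      have h2 : (π⁻¹ i).val = (π⁻¹ k).val ↔ i.val = k.val := by
        rw [← Fin.ext_iff, π⁻¹.injective.eq_iff, Fin.ext_iff]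
      simp only [Fin.lt_def, Fin.le_def, Fin.ext_iff] at *
      split_ifs <;> omega
    rw [hleft, hright, ← Finset.sum_add_distrib, Finset.sum_congr rfl (fun i _ => hpt i),
      Finset.sum_add_distrib, Finset.sum_add_distrib, Finset.sum_ite_eq',
      if_pos (Finset.mem_univ k), val_apply_eq_sum, add_assoc]

/-! ### Passing from `Des ⊆ S` to `Des = S` -/

theorem genPoly_descSubset {n : ℕ} (P S : Finset ℕ) (st : Perm (Fin n) → ℕ) :
    genPoly (descSubset n P S) st = ∑ T ∈ S.powerset, genPoly (descEq n P T) st := by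
  unfold genPoly
  rw [← Finset.sum_fiberwise_of_maps_to (g := Des) (t := S.powerset)]
  · refine Finset.sum_congr rfl fun T hT => Finset.sum_congr ?_ fun _ _ => rfl
    rw [Finset.mem_powerset] at hT
    ext π
    simp only [descSubset, descEq, Finset.mem_filter, Finset.mem_univ, true_and]
    constructor
    · exact fun h => ⟨h.1.1, h.2⟩
    · exact fun h => ⟨⟨h.1, h.2.trans_subset hT⟩, h.2⟩
  · intro π hπ
    simp only [descSubset, Finset.mem_filter, Finset.mem_univ, true_and] at hπ
    exact Finset.mem_powerset.2 hπ.2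

theorem genPoly_descEq_congr {n : ℕ} {P : Finset ℕ} {st st' : Perm (Fin n) → ℕ}
    (h : ∀ S, genPoly (descSubset n P S) st = genPoly (descSubset n P S) st') (S : Finset ℕ) :
    genPoly (descEq n P S) st = genPoly (descEq n P S) st' := by
  induction S using Finset.strongInduction with
  | H S ih =>
    have hS := h S
    rw [genPoly_descSubset, genPoly_descSubset,
      ← Finset.add_sum_erase _ _ (Finset.mem_powerset_self S),
      ← Finset.add_sum_erase _ _ (Finset.mem_powerset_self S),
      Finset.sum_congr rfl (fun T hT => ih T ?_)] at hS
    · exact add_right_cancel hS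
    · rw [Finset.mem_erase, Finset.mem_powerset] at hT
      exact hT.2.ssubset_of_ne hT.1

theorem genPoly_imak {n : ℕ} {P : Finset ℕ} (hP : P ⊆ Finset.Icc 1 n) (S : Finset ℕ) :
    genPoly (descSubset n P S) imak = genPoly (descSubset n P S) inv := by
  rw [show (imak : Perm (Fin n) → ℕ) = makInsertion.stat from funext imak_eq]
  exact makInsertion.genPoly_eq invInsertion S hP

theorem genPoly_imaj (n : ℕ) (P S : Finset ℕ) :
    genPoly (descSubset n P S) imaj = genPoly (descSubset n P S) inv := by
  rw [show (imaj : Perm (Fin n) → ℕ) = iinvr 1 from funext imaj_eq_iinvr_one]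
  exact genPoly_iinvr le_rfl n P S

end PermStat

theorem theorem3p2 (n : ℕ) (hn : 1 ≤ n) (r : ℕ) (hr : 1 ≤ r) (S P : Finset ℕ)
    (hS : S ⊆ Finset.Icc 1 (n - 1)) (hP : P ⊆ Finset.Icc 1 n) :
    (PermStat.genPoly (PermStat.descSubset n P S) PermStat.inv
        = PermStat.genPoly (PermStat.descSubset n P S) PermStat.imaj ∧
      PermStat.genPoly (PermStat.descSubset n P S) PermStat.imaj
        = PermStat.genPoly (PermStat.descSubset n P S) PermStat.imak ∧
      PermStat.genPoly (PermStat.descSubset n P S) PermStat.imak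
        = PermStat.genPoly (PermStat.descSubset n P S) (PermStat.iinvr r)) ∧
    (PermStat.genPoly (PermStat.descEq n P S) PermStat.inv
        = PermStat.genPoly (PermStat.descEq n P S) PermStat.imaj ∧
      PermStat.genPoly (PermStat.descEq n P S) PermStat.imaj
        = PermStat.genPoly (PermStat.descEq n P S) PermStat.imak ∧
      PermStat.genPoly (PermStat.descEq n P S) PermStat.imak
        = PermStat.genPoly (PermStat.descEq n P S) (PermStat.iinvr r)) := by
  have hmaj := PermStat.genPoly_imaj n P
  have hmak := PermStat.genPoly_imak hP
  have hinvr := PermStat.genPoly_iinvr hr n P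
  refine ⟨⟨(hmaj S).symm, (hmaj S).trans (hmak S).symm, (hmak S).trans (hinvr S).symm⟩, ?_, ?_, ?_⟩
  · exact PermStat.genPoly_descEq_congr (fun S => (hmaj S).symm) S
  · exact PermStat.genPoly_descEq_congr (fun S => (hmaj S).trans (hmak S).symm) S
  · exact PermStat.genPoly_descEq_congr (fun S => (hmak S).trans (hinvr S).symm) S
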